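/- Let $E$ be a normed plane, i.e. a two-dimensional real normed space, with closed unit ball $B$. A bounded set $C\subset E$ is called \emph{complete} if no set of the same diameter properly contains $C$. A complete set is called a \emph{Reuleaux polygon} if it is the intersection of finitely many translates of $B$. For an integer $k\ge 1$ and a bounded set $S\subset E$ of diameter $d>0$, the \emph{$k$-fold Borsuk number} $a_k(S)$ is the smallest cardinality of a family (in which sets may be repeated) of subsets of $S$, each of diameter strictly less than $d$, such that every point of $S$ belongs to at least $k$ members of the family. \textbf{Theorem.} Let $C\subset E$ be a complete set of diameter one that is not a Reuleaux polygon. Then $a_k(C)=2k+1$ for every integer $k\ge 1$. -/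

import Mathlib

/-- A bounded set `C` is (diametrically) complete if no set of the same diameter properly
contains it. Boundedness of `T` says that its diameter is a genuine real number. -/
def IsDiametricallyComplete {E : Type*} [NormedAddCommGroup E] (C : Set E) : Prop :=
  Bornology.IsBounded C ∧
    ∀ T : Set E, Bornology.IsBounded T → Metric.diam T = Metric.diam C → C ⊆ T → T = C

/-- A Reuleaux polygon: a complete set that is the intersection of finitely many translates of
the closed unit ball. -/
def IsReuleauxPolygon {E : Type*} [NormedAddCommGroup E] (C : Set E) : Prop :=
  IsDiametricallyComplete C ∧ ∃ X : Finset E, C = ⋂ x ∈ X, Metric.closedBall x 1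

/-- `F` is a `k`-fold Borsuk covering of the bounded set `S`: a finite indexed family (members may
be repeated) of subsets of `S`, each of diameter strictly less than that of `S`, such that every
point of `S` belongs to at least `k` members. -/
def IsKFoldBorsukCovering {E : Type*} [NormedAddCommGroup E] (k : ℕ) (S : Set E) {n : ℕ}
    (F : Fin n → Set E) : Prop :=
  (∀ i, F i ⊆ S ∧ Metric.diam (F i) < Metric.diam S) ∧
    ∀ x ∈ S, k ≤ {i : Fin n | x ∈ F i}.ncard

/-- The `k`-fold Borsuk number of `S`: the smallest cardinality of a `k`-fold Borsuk covering
(and `⊤` if there is no finite one). -/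
noncomputable def kFoldBorsukNumber {E : Type*} [NormedAddCommGroup E] (k : ℕ) (S : Set E) : ℕ∞ :=
  ⨅ n : ℕ, ⨅ _ : ∃ F : Fin n → Set E, IsKFoldBorsukCovering k S F, (n : ℕ∞)

/-! Lower bound: two points at distance one never lie in the closure of the same member. Every
boundary point of `C` has a diametral partner, so with at most `2 * k` members it lies in exactly
`k` closures. The index set of these closures is then locally constant on the connected boundary,
yet disjoint for diametral partners (`IsKFoldBorsukCovering.two_mul_lt`).

Upper bound: boundary points are sorted by the angles of their outer normals. The ends of a diameter
have normal angles `φ` and `φ + π`, so an arc of angles carries no diameter once it is fenced,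
inside a half-turn, by faces disjoint from those at its ends (`IsDualFrame.dist_ne_one_of_guard`).
Suppose that on one side of some angle `u` no point keeps all the nearby normals, nor all the
opposite ones. Then fences can be inserted indefinitely towards `u`, and `k` full turns split into
`2 * k + 1` fenced arcs (`NormalsAccumulate.exists_covering`). If there is no such `u`, then near
each angle, on either side, one point serves all diameters as an end; by compactness finitely many
partners suffice, and their unit balls cut out `C` (`IsDualFrame.isReuleauxPolygon`). -/

section

open Set Metric Real

/-! ### Complete sets of diameter one. -/

section Complete

variable {E : Type*} [NormedAddCommGroup E] {C : Set E}

namespace IsDiametricallyComplete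

theorem nonempty_of_diam_eq_one (hd : diam C = 1) : C.Nonempty := by
  rw [nonempty_iff_ne_empty]
  rintro rfl
  simp at hd

theorem dist_le_one (hC : IsDiametricallyComplete C) (hd : diam C = 1) {x y : E} (hx : x ∈ C)
    (hy : y ∈ C) : dist x y ≤ 1 :=
  hd ▸ dist_le_diam_of_mem hC.1 hx hy

theorem mem_of_dist_le (hC : IsDiametricallyComplete C) (hd : diam C = 1) {z : E}
    (hz : ∀ y ∈ C, dist z y ≤ 1) : z ∈ C := by
  have hb : Bornology.IsBounded (insert z C) := hC.1.insert z
  have h : insert z C = C := by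
    refine hC.2 _ hb (le_antisymm ?_ (diam_mono (subset_insert z C) hb)) (subset_insert z C)
    rw [hd]
    refine diam_le_of_forall_dist_le zero_le_one ?_
    rintro a (rfl | ha) b (rfl | hb)
    · simp
    · exact hz b hb
    · rw [dist_comm]; exact hz a ha
    · exact hC.dist_le_one hd ha hb
  exact h ▸ mem_insert z C

theorem eq_iInter (hC : IsDiametricallyComplete C) (hd : diam C = 1) :
    C = ⋂ y ∈ C, closedBall y 1 := by
  ext z
  simp only [mem_iInter, mem_closedBall]
  exact ⟨fun hz y hy => hC.dist_le_one hd hz hy, fun h => hC.mem_of_dist_le hd h⟩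

theorem isClosed (hC : IsDiametricallyComplete C) (hd : diam C = 1) : IsClosed C := by
  rw [hC.eq_iInter hd]
  exact isClosed_biInter fun _ _ => isClosed_closedBall

theorem isCompact [ProperSpace E] (hC : IsDiametricallyComplete C) (hd : diam C = 1) :
    IsCompact C :=
  isCompact_of_isClosed_isBounded (hC.isClosed hd) hC.1

theorem mem_interior [ProperSpace E] (hC : IsDiametricallyComplete C) (hd : diam C = 1) {z : E}
    (hz : ∀ y ∈ C, dist z y < 1) : z ∈ interior C := by
  obtain ⟨y, hy, hmax⟩ := (hC.isCompact hd).exists_isMaxOn (nonempty_of_diam_eq_one hd)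
    (f := fun y => dist z y) (by fun_prop)
  rw [mem_interior_iff_mem_nhds, Metric.mem_nhds_iff]
  refine ⟨1 - dist z y, by linarith [hz y hy], fun w hw => hC.mem_of_dist_le hd fun v hv => ?_⟩
  have h1 : dist z v ≤ dist z y := hmax hv
  have h2 := dist_triangle w z v
  rw [mem_ball] at hw
  linarith

theorem exists_dist_eq_one [ProperSpace E] (hC : IsDiametricallyComplete C) (hd : diam C = 1)
    {x : E} (hx : x ∈ C) (hxi : x ∉ interior C) : ∃ y ∈ C, dist x y = 1 := by
  by_contra! h
  exact hxi (hC.mem_interior hd fun y hy => lt_of_le_of_ne (hC.dist_le_one hd hx hy) (h y hy))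

variable [NormedSpace ℝ E]

theorem convex (hC : IsDiametricallyComplete C) (hd : diam C = 1) : Convex ℝ C := by
  rw [hC.eq_iInter hd]
  exact convex_iInter₂ fun _ _ => convex_closedBall _ _

/-- The average of a finite net of mesh less than one has distance less than one from every
point of a complete set of diameter one. -/
theorem exists_forall_dist_lt_one [ProperSpace E] (hC : IsDiametricallyComplete C)
    (hd : diam C = 1) : ∃ o ∈ C, ∀ y ∈ C, dist o y < 1 := by
  obtain ⟨t, htC, htf, hcov⟩ := finite_cover_balls_of_compact (hC.isCompact hd) zero_lt_one
  lift t to Finset E using htf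
  obtain ⟨c, hc⟩ := nonempty_of_diam_eq_one hd
  have hne : t.Nonempty := by
    obtain ⟨x, hx, -⟩ := mem_iUnion₂.1 (hcov hc)
    exact ⟨x, hx⟩
  have hpos : (0 : ℝ) < t.card := by exact_mod_cast hne.card_pos
  set o : E := (t.card : ℝ)⁻¹ • ∑ x ∈ t, x with ho
  have hdist : ∀ y ∈ C, dist o y < 1 := by
    intro y hy
    have h1 : o - y = (t.card : ℝ)⁻¹ • ∑ x ∈ t, (x - y) := by
      rw [Finset.sum_sub_distrib, smul_sub, Finset.sum_const, ← Nat.cast_smul_eq_nsmul ℝ,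
        inv_smul_smul₀ hpos.ne']
    have h2 : ∑ x ∈ t, ‖x - y‖ < ∑ _x ∈ t, (1 : ℝ) := by
      obtain ⟨x, hx, hxy⟩ := mem_iUnion₂.1 (hcov hy)
      refine Finset.sum_lt_sum (fun x hx => ?_) ⟨x, hx, ?_⟩
      · rw [← dist_eq_norm]; exact hC.dist_le_one hd (htC hx) hy
      · rw [← dist_eq_norm, dist_comm]; exact hxy
    rw [dist_eq_norm, h1, norm_smul, norm_inv, Real.norm_natCast, inv_mul_lt_iff₀ hpos]
    refine (norm_sum_le _ _).trans_lt (h2.trans_eq ?_)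
    simp
  exact ⟨o, hC.mem_of_dist_le hd fun y hy => (hdist y hy).le, hdist⟩

end IsDiametricallyComplete

end Complete

/-! ### Connectedness of the boundary of a convex body. -/

section Frontier

variable {E : Type*} [NormedAddCommGroup E] [NormedSpace ℝ E] {C : Set E}

/-- Radial projection from `o`, by means of the gauge, maps the connected punctured space onto the
boundary. -/
theorem isPreconnected_frontier_of_convex (hE : 1 < Module.rank ℝ E) (hconv : Convex ℝ C)
    (hb : Bornology.IsBounded C) {o : E} (ho : o ∈ interior C) : IsPreconnected (frontier C) := by
  set D : Set E := (fun v => o + v) ⁻¹' C with hD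
  have hDconv : Convex ℝ D := hconv.translate_preimage_right o
  have hfr : (fun v => o + v) ⁻¹' frontier C = frontier D :=
    (Homeomorph.addLeft o).preimage_frontier C
  have hint : (fun v => o + v) ⁻¹' interior C = interior D :=
    (Homeomorph.addLeft o).preimage_interior C
  have h0 : D ∈ nhds (0 : E) := by
    rw [← mem_interior_iff_mem_nhds, ← hint]; simpa using ho
  have hDb : Bornology.IsBounded D := by
    have h2 : D = (fun w => -o + w) '' C := by
      ext v
      simp only [hD, mem_preimage, mem_image]
      exact ⟨fun h => ⟨_, h, by abel⟩, by rintro ⟨w, hw, rfl⟩; simpa using hw⟩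
    rw [h2]
    obtain ⟨R, hR⟩ := hb.exists_norm_le
    refine isBounded_iff_forall_norm_le.2 ⟨‖o‖ + R, ?_⟩
    rintro _ ⟨w, hw, rfl⟩
    calc ‖-o + w‖ ≤ ‖-o‖ + ‖w‖ := norm_add_le _ _
      _ ≤ ‖o‖ + R := by rw [norm_neg]; linarith [hR w hw]
  have habs : Absorbent ℝ D := absorbent_nhds_zero h0
  have hpos : ∀ v : E, v ≠ 0 → 0 < gauge D v := fun v hv =>
    (gauge_pos habs ((NormedSpace.isVonNBounded_iff ℝ).2 hDb)).2 hv
  have hcont : Continuous (gauge D) := continuous_gauge hDconv h0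
  have himg : (fun v => o + (gauge D v)⁻¹ • v) '' {0}ᶜ = frontier C := by
    ext p
    constructor
    · rintro ⟨v, hv, rfl⟩
      have : (gauge D v)⁻¹ • v ∈ (fun v => o + v) ⁻¹' frontier C := by
        rw [hfr, ← gauge_eq_one_iff_mem_frontier hDconv h0,
          gauge_smul_of_nonneg (inv_nonneg.2 (gauge_nonneg v)), smul_eq_mul,
          inv_mul_cancel₀ (hpos v hv).ne']
      exact this
    · intro hp
      have h1 : p - o ∈ frontier D := by rw [← hfr]; simpa using hp
      have h2 := (gauge_eq_one_iff_mem_frontier hDconv h0).2 h1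
      refine ⟨p - o, ?_, ?_⟩
      · intro h
        rw [mem_singleton_iff] at h
        rw [h, gauge_zero] at h2
        exact zero_ne_one h2
      · simp [h2]
  rw [← himg]
  refine (isConnected_compl_singleton_of_one_lt_rank hE 0).isPreconnected.image _ ?_
  exact continuousOn_const.add ((hcont.continuousOn.inv₀ fun v hv => (hpos v hv).ne').smul
    continuousOn_id)

end Frontier

/-! ### The lower bound. -/

section Lower

variable {E : Type*} [NormedAddCommGroup E] [NormedSpace ℝ E] {C : Set E}

/-- A `k`-fold Borsuk covering of a complete planar set has more than `2 * k` members. -/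
theorem IsKFoldBorsukCovering.two_mul_lt [ProperSpace E] (hE : 1 < Module.rank ℝ E)
    (hC : IsDiametricallyComplete C)
    (hd : diam C = 1) {k n : ℕ} (hk : 1 ≤ k) {F : Fin n → Set E}
    (hF : IsKFoldBorsukCovering k C F) : 2 * k < n := by
  classical
  by_contra! hn
  have hcl := hC.isClosed hd
  obtain ⟨o, hoC, ho⟩ := hC.exists_forall_dist_lt_one hd
  have hoi := hC.mem_interior hd ho
  let I : E → Finset (Fin n) := fun p => {i | p ∈ closure (F i)}
  have hI : ∀ p i, i ∈ I p ↔ p ∈ closure (F i) := fun p i => by simp [I]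
  have hcard : ∀ p ∈ C, k ≤ (I p).card := by
    intro p hp
    refine (hF.2 p hp).trans ?_
    rw [← Set.ncard_coe_finset]
    refine Set.ncard_le_ncard (fun i hi => ?_) (Finset.finite_toSet _)
    exact (hI p i).2 (subset_closure hi)
  have hfrC : frontier C ⊆ C := hcl.frontier_subset
  -- An interior `p` could be pushed away from `q` inside `C`, to distance `1 + ε / 2`.
  have hmemfr : ∀ p ∈ C, ∀ q ∈ C, dist p q = 1 → p ∈ frontier C := by
    intro p hp q hq hpq
    refine ⟨subset_closure hp, fun hpi => ?_⟩
    rw [mem_interior_iff_mem_nhds, Metric.mem_nhds_iff] at hpi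
    obtain ⟨ε, hε, hball⟩ := hpi
    have h1 : p + (ε / 2) • (p - q) ∈ C := hball (by
      rw [mem_ball, dist_eq_norm, add_sub_cancel_left, norm_smul, ← dist_eq_norm, hpq,
        Real.norm_of_nonneg (by positivity)]
      linarith)
    have h2 := hC.dist_le_one hd h1 hq
    have h3 : p + (ε / 2) • (p - q) - q = (1 + ε / 2) • (p - q) := by module
    rw [dist_eq_norm, h3, norm_smul, ← dist_eq_norm, hpq, Real.norm_of_nonneg (by positivity)] at h2
    linarith
  have hdisj : ∀ p ∈ C, ∀ q ∈ C, dist p q = 1 → Disjoint (I p) (I q) := by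
    intro p hp q hq hpq
    rw [Finset.disjoint_left]
    intro i hip hiq
    rw [hI] at hip hiq
    have h1 := dist_le_diam_of_mem ((hC.1.subset (hF.1 i).1).closure) hip hiq
    rw [diam_closure, hpq] at h1
    have := (hF.1 i).2
    rw [hd] at this
    linarith
  have hcard_eq : ∀ p ∈ frontier C, (I p).card = k := by
    intro p hp
    obtain ⟨q, hq, hpq⟩ := hC.exists_dist_eq_one hd (hfrC hp) hp.2
    have h1 := Finset.card_union_of_disjoint (hdisj p (hfrC hp) q hq hpq)
    have h2 := Finset.card_le_univ (I p ∪ I q)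
    rw [Fintype.card_fin] at h2
    have := hcard q hq
    have := hcard p (hfrC hp)
    omega
  have hconn := isPreconnected_frontier_of_convex hE (hC.convex hd) hC.1 hoi
  -- Closedness gives `I q ⊆ I p` for `q` near `p`; equal cardinalities turn this into equality.
  have hloc : IsLocallyConstant fun p : frontier C => I p := by
    rw [IsLocallyConstant.iff_eventually_eq]
    intro p
    have h1 : ∀ᶠ q in nhds (p : E), ∀ i, i ∉ I p → q ∉ closure (F i) := by
      rw [Filter.eventually_all]
      intro i
      by_cases hi : i ∈ I p
      · simp [hi]
      · filter_upwards [isClosed_closure.isOpen_compl.mem_nhds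
          (show (p : E) ∈ (closure (F i))ᶜ from fun h => hi ((hI _ _).2 h))] with q hq _ using hq
    filter_upwards [continuous_subtype_val.continuousAt.eventually h1] with q hq
    refine Finset.eq_of_subset_of_card_le (fun i hi => ?_) ?_
    · by_contra hip
      exact hq i hip ((hI _ _).1 hi)
    · rw [hcard_eq _ p.2, hcard_eq _ q.2]
  obtain ⟨p, hpfr⟩ : (frontier C).Nonempty := by
    by_contra! hempty
    have hclopen : IsClopen C := isClopen_iff_frontier_eq_empty.2 hempty
    rcases isClopen_iff.1 hclopen with h | h
    · exact (IsDiametricallyComplete.nonempty_of_diam_eq_one hd).ne_empty h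
    · have : Nontrivial E := (rank_pos_iff_nontrivial (R := ℝ)).1 (zero_lt_one.trans hE)
      exact NormedSpace.unbounded_univ ℝ E (h ▸ hC.1)
  obtain ⟨q, hq, hpq⟩ := hC.exists_dist_eq_one hd (hfrC hpfr) hpfr.2
  have hqfr := hmemfr q hq p (hfrC hpfr) (by rw [dist_comm, hpq])
  have : PreconnectedSpace (frontier C) := Subtype.preconnectedSpace hconn
  have heq : I p = I q := hloc.apply_eq_of_preconnectedSpace ⟨p, hpfr⟩ ⟨q, hqfr⟩
  have h1 := hdisj p (hfrC hpfr) q hq hpq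
  rw [← heq, disjoint_self] at h1
  have := hcard_eq p hpfr
  simp [h1] at this
  omega

end Lower

/-! ### Normal angles and support faces in the plane. -/

section Directions

variable {E : Type*} [NormedAddCommGroup E] [NormedSpace ℝ E]

/-- The functional with polar angle `θ` in the frame `f`, `g` of the dual space. -/
noncomputable def angleFunctional (f g : StrongDual ℝ E) (θ : ℝ) : StrongDual ℝ E :=
  cos θ • f + sin θ • g

/-- The points of `C` at which the functional with polar angle `θ` attains its maximum on `C`. -/
def supportFace (f g : StrongDual ℝ E) (C : Set E) (θ : ℝ) : Set E :=
  {x | x ∈ C ∧ ∀ y ∈ C, angleFunctional f g θ y ≤ angleFunctional f g θ x}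

/-- The functionals `f` and `g` form a basis of the dual space. -/
structure IsDualFrame (f g : StrongDual ℝ E) : Prop where
  exists_eq : ∀ φ : StrongDual ℝ E, ∃ a b : ℝ, φ = a • f + b • g
  eq_zero : ∀ a b : ℝ, a • f + b • g = 0 → a = 0 ∧ b = 0

variable {f g : StrongDual ℝ E} {C : Set E}

theorem angleFunctional_apply (f g : StrongDual ℝ E) (θ : ℝ) (x : E) :
    angleFunctional f g θ x = cos θ * f x + sin θ * g x := by
  simp [angleFunctional]

theorem angleFunctional_add_pi (f g : StrongDual ℝ E) (θ : ℝ) :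
    angleFunctional f g (θ + π) = -angleFunctional f g θ := by
  ext x
  simp [angleFunctional_apply, cos_add_pi, sin_add_pi]
  ring

theorem angleFunctional_add_int_mul_two_pi (f g : StrongDual ℝ E) (θ : ℝ) (n : ℤ) :
    angleFunctional f g (θ + n * (2 * π)) = angleFunctional f g θ := by
  ext x
  simp [angleFunctional_apply]

theorem angleFunctional_neg_right (f g : StrongDual ℝ E) (θ : ℝ) :
    angleFunctional f (-g) θ = angleFunctional f g (-θ) := by
  ext x
  simp [angleFunctional_apply]

/-- For `α ≤ γ ≤ β < α + π` the coefficients on the right are nonnegative: the middle functional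
lies in the cone of the outer two. -/
theorem sin_mul_angleFunctional (f g : StrongDual ℝ E) (α γ β : ℝ) (x : E) :
    sin (β - α) * angleFunctional f g γ x =
      sin (β - γ) * angleFunctional f g α x + sin (γ - α) * angleFunctional f g β x := by
  simp only [angleFunctional_apply, sin_sub]
  ring

theorem supportFace_add_int_mul_two_pi (θ : ℝ) (n : ℤ) :
    supportFace f g C (θ + n * (2 * π)) = supportFace f g C θ := by
  simp only [supportFace, angleFunctional_add_int_mul_two_pi]

theorem supportFace_neg_right (θ : ℝ) :
    supportFace f (-g) C θ = supportFace f g C (-θ) := by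
  simp only [supportFace, angleFunctional_neg_right]

theorem mem_supportFace_add_pi {x : E} {θ : ℝ} :
    x ∈ supportFace f g C (θ + π) ↔
      x ∈ C ∧ ∀ y ∈ C, angleFunctional f g θ x ≤ angleFunctional f g θ y := by
  simp [supportFace, angleFunctional_add_pi]

namespace IsDualFrame

theorem neg_right (h : IsDualFrame f g) : IsDualFrame f (-g) where
  exists_eq φ := by
    obtain ⟨a, b, rfl⟩ := h.exists_eq φ
    exact ⟨a, -b, by simp⟩
  eq_zero a b hab := by
    have := h.eq_zero a (-b) (by ext x; simpa using DFunLike.congr_fun hab x)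
    exact ⟨this.1, neg_eq_zero.1 this.2⟩

theorem angleFunctional_ne_zero (h : IsDualFrame f g) (θ : ℝ) : angleFunctional f g θ ≠ 0 := by
  intro h0
  obtain ⟨h1, h2⟩ := h.eq_zero _ _ h0
  have := sin_sq_add_cos_sq θ
  simp [h1, h2] at this

theorem exists_eq_smul_angleFunctional (h : IsDualFrame f g) {φ : StrongDual ℝ E} (hφ : φ ≠ 0) :
    ∃ r : ℝ, 0 < r ∧ ∃ θ, φ = r • angleFunctional f g θ := by
  obtain ⟨a, b, rfl⟩ := h.exists_eq φ
  set z : ℂ := ⟨a, b⟩ with hz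
  refine ⟨‖z‖, norm_pos_iff.2 fun h0 => hφ ?_, z.arg, ?_⟩
  · have h1 : a = 0 := congrArg Complex.re h0
    have h2 : b = 0 := congrArg Complex.im h0
    simp [h1, h2]
  · have h1 : ‖z‖ * cos z.arg = a := Complex.norm_mul_cos_arg z
    have h2 : ‖z‖ * sin z.arg = b := Complex.norm_mul_sin_arg z
    rw [angleFunctional, smul_add, smul_smul, smul_smul, h1, h2]

theorem eq_of_apply_eq (h : IsDualFrame f g) {α β : ℝ} (hαβ : α < β) (hβα : β < α + π) {x y : E}
    (hα : angleFunctional f g α x = angleFunctional f g α y)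
    (hβ : angleFunctional f g β x = angleFunctional f g β y) : x = y := by
  have hs : 0 < sin (β - α) := sin_pos_of_pos_of_lt_pi (by linarith) (by linarith)
  have key : ∀ γ, angleFunctional f g γ x = angleFunctional f g γ y := by
    intro γ
    have h1 := sin_mul_angleFunctional f g α γ β x
    rw [hα, hβ, ← sin_mul_angleFunctional] at h1
    exact mul_left_cancel₀ hs.ne' h1
  have hf : f x = f y := by simpa [angleFunctional_apply] using key 0
  have hg : g x = g y := by simpa [angleFunctional_apply] using key (π / 2)
  rw [← sub_eq_zero]
  by_contra hne
  obtain ⟨φ, -, hφ⟩ := exists_dual_vector ℝ (x - y) (norm_ne_zero_iff.2 hne)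
  obtain ⟨a, b, rfl⟩ := h.exists_eq φ
  rw [map_sub, sub_eq_zero.2 (by simp [hf, hg])] at hφ
  exact hne (norm_eq_zero.1 hφ.symm)

end IsDualFrame

theorem supportFace_subset (θ : ℝ) : supportFace f g C θ ⊆ C := fun _ hx => hx.1

theorem angleFunctional_eq_of_mem_supportFace {x y : E} {θ : ℝ} (hx : x ∈ supportFace f g C θ)
    (hy : y ∈ supportFace f g C θ) : angleFunctional f g θ x = angleFunctional f g θ y :=
  le_antisymm (hy.2 x hx.1) (hx.2 y hy.1)

theorem IsCompact.supportFace (hC : IsCompact C) (θ : ℝ) :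
    IsCompact (supportFace f g C θ) := by
  have : _root_.supportFace f g C θ =
      C ∩ ⋂ y ∈ C, {x | angleFunctional f g θ y ≤ angleFunctional f g θ x} := by
    ext x; simp [_root_.supportFace]
  rw [this]
  exact hC.inter_right (isClosed_biInter fun y _ =>
    isClosed_le continuous_const (angleFunctional f g θ).continuous)

theorem IsCompact.supportFace_nonempty (hC : IsCompact C) (hne : C.Nonempty) (θ : ℝ) :
    (_root_.supportFace f g C θ).Nonempty := by
  obtain ⟨x, hx, hmax⟩ := hC.exists_isMaxOn hne (angleFunctional f g θ).continuous.continuousOn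
  exact ⟨x, hx, fun y hy => hmax hy⟩

theorem mem_supportFace_of_between {α γ β : ℝ} (h1 : α ≤ γ) (h2 : γ ≤ β) (h3 : β < α + π) {x : E}
    (hα : x ∈ supportFace f g C α) (hβ : x ∈ supportFace f g C β) : x ∈ supportFace f g C γ := by
  rcases eq_or_lt_of_le (h1.trans h2) with h | h
  · obtain rfl : γ = α := le_antisymm (h ▸ h2) h1
    exact hα
  · refine ⟨hα.1, fun y hy => ?_⟩
    have hs : 0 < sin (β - α) := sin_pos_of_pos_of_lt_pi (by linarith) (by linarith)
    refine le_of_mul_le_mul_left ?_ hs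
    have ha : 0 ≤ sin (β - γ) := sin_nonneg_of_nonneg_of_le_pi (by linarith) (by linarith)
    have hb : 0 ≤ sin (γ - α) := sin_nonneg_of_nonneg_of_le_pi (by linarith) (by linarith)
    rw [sin_mul_angleFunctional, sin_mul_angleFunctional f g α γ β x]
    exact add_le_add (mul_le_mul_of_nonneg_left (hα.2 y hy) ha)
      (mul_le_mul_of_nonneg_left (hβ.2 y hy) hb)

/-- A point exposed by two angles is the only point exposed by an angle strictly in between. -/
theorem IsDualFrame.eq_of_mem_supportFace (h : IsDualFrame f g) {α γ β : ℝ} (h1 : α < γ) (h2 : γ < β)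
    (h3 : β < α + π) {x p : E} (hα : x ∈ supportFace f g C α) (hβ : x ∈ supportFace f g C β)
    (hp : p ∈ supportFace f g C γ) : p = x := by
  have hx := mem_supportFace_of_between h1.le h2.le h3 hα hβ
  have hs : 0 < sin (β - α) := sin_pos_of_pos_of_lt_pi (by linarith) (by linarith)
  have ha : 0 < sin (β - γ) := sin_pos_of_pos_of_lt_pi (by linarith) (by linarith)
  have hb : 0 < sin (γ - α) := sin_pos_of_pos_of_lt_pi (by linarith) (by linarith)
  have e := congrArg (sin (β - α) * ·) (angleFunctional_eq_of_mem_supportFace hp hx)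
  beta_reduce at e
  rw [sin_mul_angleFunctional, sin_mul_angleFunctional f g α γ β x] at e
  have l1 := mul_le_mul_of_nonneg_left (hα.2 p hp.1) ha.le
  have l2 := mul_le_mul_of_nonneg_left (hβ.2 p hp.1) hb.le
  refine h.eq_of_apply_eq (h1.trans h2) h3 (mul_left_cancel₀ ha.ne' ?_)
    (mul_left_cancel₀ hb.ne' ?_) <;> linarith

/-- The endpoint of the face at `α` that lies on every face meeting it at a smaller angle. -/
theorem exists_supportFace_endpoint (hC : IsCompact C) (hne : C.Nonempty) (α : ℝ) :
    ∃ l ∈ supportFace f g C α, ∀ θ, α - π < θ → θ < α →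
      ¬ Disjoint (supportFace f g C θ) (supportFace f g C α) → l ∈ supportFace f g C θ := by
  -- The functional at `θ` combines those at `α - π / 2` and `α`, the former with coefficient `sin
  -- (α - θ) ≥ 0`; the latter is constant on the face.
  obtain ⟨l, hl, hmax⟩ := (hC.supportFace (f := f) (g := g) α).exists_isMaxOn
    (hC.supportFace_nonempty hne α) (angleFunctional f g (α - π / 2)).continuous.continuousOn
  refine ⟨l, hl, fun θ h1 h2 h3 => ?_⟩
  obtain ⟨x, hxθ, hxα⟩ := not_disjoint_iff.1 h3
  refine ⟨hl.1, fun y hy => (hxθ.2 y hy).trans ?_⟩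
  have e1 := sin_mul_angleFunctional f g (α - π / 2) θ α x
  have e2 := sin_mul_angleFunctional f g (α - π / 2) θ α l
  rw [sub_sub_cancel, sin_pi_div_two, one_mul] at e1 e2
  rw [e1, e2, angleFunctional_eq_of_mem_supportFace hxα hl]
  have := mul_le_mul_of_nonneg_left (hmax hxα : angleFunctional f g (α - π / 2) x ≤ _)
    (sin_nonneg_of_nonneg_of_le_pi (x := α - θ) (by linarith) (by linarith))
  linarith

theorem lt_of_mem_interior {o : E} (ho : o ∈ interior C) {φ : StrongDual ℝ E} (hφ : φ ≠ 0) {M : ℝ}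
    (hM : ∀ y ∈ C, φ y ≤ M) : φ o < M := by
  obtain ⟨v, hv⟩ : ∃ v, 0 < φ v := by
    obtain ⟨v, hv⟩ := DFunLike.ne_iff.1 hφ
    rcases lt_or_gt_of_ne hv with h | h
    · exact ⟨-v, by simpa using h⟩
    · exact ⟨v, h⟩
  have hcont : Filter.Tendsto (fun t : ℝ => o + t • v) (nhds 0) (nhds o) := by
    have : Continuous fun t : ℝ => o + t • v := by fun_prop
    simpa using this.tendsto 0
  have h1 : ∀ᶠ t : ℝ in nhdsWithin 0 (Ioi 0), o + t • v ∈ C :=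
    (hcont.eventually (mem_interior_iff_mem_nhds.1 ho)).filter_mono nhdsWithin_le_nhds
  obtain ⟨t, ht, ht0⟩ := (h1.and self_mem_nhdsWithin).exists
  have h2 := hM _ ht
  rw [map_add, map_smul, smul_eq_mul] at h2
  have : 0 < t * φ v := mul_pos ht0 hv
  linarith

theorem exists_mem_segment_notMem_interior (hC : IsClosed C) {a w : E} (ha : a ∈ C) (hw : w ∉ C) :
    ∃ x ∈ segment ℝ a w, x ∈ C ∧ x ∉ interior C := by
  by_contra! h
  have hsub : segment ℝ a w ⊆ interior C ∪ Cᶜ := by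
    intro x hx
    by_cases hxC : x ∈ C
    · exact Or.inl (h x hx hxC)
    · exact Or.inr hxC
  have hpre : IsPreconnected (segment ℝ a w) := (convex_segment a w).isPreconnected
  have := hpre.subset_left_of_subset_union isOpen_interior hC.isOpen_compl
    (disjoint_compl_right.mono_left interior_subset) hsub
    ⟨a, left_mem_segment ℝ a w, h a (left_mem_segment ℝ a w) ha⟩
  exact hw (interior_subset (this (right_mem_segment ℝ a w)))

end Directions

/-! ### From fenced arcs of normal angles to coverings. -/

section Covering

variable {E : Type*} [NormedAddCommGroup E] [NormedSpace ℝ E] {f g : StrongDual ℝ E} {C : Set E}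

/-- A functional norming `x - y` varies on `C` by at most its norm, and `x`, `y` attain this
variation. -/
theorem IsDualFrame.exists_angle_of_dist_eq_one (h : IsDualFrame f g)
    (hle : ∀ x ∈ C, ∀ y ∈ C, dist x y ≤ 1) {x y : E} (hx : x ∈ C) (hy : y ∈ C)
    (hxy : dist x y = 1) :
    ∃ φ, x ∈ supportFace f g C φ ∧ y ∈ supportFace f g C (φ + π) ∧
      angleFunctional f g φ (x - y) = ‖angleFunctional f g φ‖ := by
  rw [dist_eq_norm] at hxy
  obtain ⟨ℓ, hℓ, hv⟩ := exists_dual_vector ℝ (x - y) (by rw [hxy]; exact one_ne_zero)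
  obtain ⟨r, hr, φ, rfl⟩ := h.exists_eq_smul_angleFunctional
    (show ℓ ≠ 0 from fun h0 => by simp [h0] at hℓ)
  have hnorm : r * ‖angleFunctional f g φ‖ = 1 := by
    rwa [norm_smul, Real.norm_of_nonneg hr.le] at hℓ
  have hval : r * angleFunctional f g φ (x - y) = 1 := by
    rw [hxy] at hv; exact hv
  have hbound : ∀ z ∈ C, ∀ w ∈ C,
      angleFunctional f g φ (z - w) ≤ angleFunctional f g φ (x - y) := by
    intro z hz w hw
    refine le_of_mul_le_mul_left ?_ hr
    calc r * angleFunctional f g φ (z - w)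
        ≤ r * (‖angleFunctional f g φ‖ * ‖z - w‖) :=
          mul_le_mul_of_nonneg_left ((le_abs_self _).trans
            ((angleFunctional f g φ).le_opNorm (z - w))) hr.le
      _ = dist z w := by rw [← mul_assoc, hnorm, one_mul, dist_eq_norm]
      _ ≤ r * angleFunctional f g φ (x - y) := (hle z hz w hw).trans hval.ge
  refine ⟨φ, ⟨hx, fun z hz => ?_⟩, mem_supportFace_add_pi.2 ⟨hy, fun z hz => ?_⟩, ?_⟩
  · have := hbound z hz y hy
    simp only [map_sub] at this
    linarith
  · have := hbound x hx z hz
    simp only [map_sub] at this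
    linarith
  · exact mul_left_cancel₀ hr.ne' (hval.trans hnorm.symm)

theorem IsDualFrame.notMem_supportFace_add_pi (h : IsDualFrame f g) {o : E} (ho : o ∈ interior C)
    {x : E} {θ : ℝ} (hx : x ∈ supportFace f g C θ) : x ∉ supportFace f g C (θ + π) := by
  intro hx'
  have h1 := lt_of_mem_interior ho (h.angleFunctional_ne_zero θ) hx.2
  have h2 := (mem_supportFace_add_pi.1 hx').2 o (interior_subset ho)
  linarith

/-- Normal angles of boundary points over `[α, β]` stay inside `(a, b)`, up to full turns, if the
faces at `a` and `b` are disjoint from those at `α` and `β`. -/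
theorem IsDualFrame.exists_int_mem_Ioo (h : IsDualFrame f g) {o : E} (ho : o ∈ interior C)
    {a α β b θ φ : ℝ} (haα : a < α) (hβb : β < b)
    (hα : Disjoint (supportFace f g C α) (supportFace f g C a))
    (hβ : Disjoint (supportFace f g C β) (supportFace f g C b))
    (hθ : θ ∈ Icc α β) {x : E} (hx : x ∈ supportFace f g C θ) (hφ : x ∈ supportFace f g C φ) :
    ∃ n : ℤ, φ + n * (2 * π) ∈ Ioo a b := by
  -- The lift of `φ` is taken within `π` of `θ`. Were it outside `(a, b)`, all angles between it and
  -- `θ` would be normal to `x`, putting `x` in two disjoint faces.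
  obtain ⟨n, hn, -⟩ := existsUnique_add_zsmul_mem_Ioc (two_pi_pos) φ (θ - π)
  rw [zsmul_eq_mul] at hn
  refine ⟨n, ?_⟩
  rw [← supportFace_add_int_mul_two_pi φ n] at hφ
  set ψ := φ + n * (2 * π) with hψ
  have hlt : ψ < θ + π := by
    refine lt_of_le_of_ne (by linarith [hn.2]) fun he => ?_
    rw [he] at hφ
    exact h.notMem_supportFace_add_pi ho hx hφ
  constructor
  · by_contra! hle
    exact disjoint_left.1 hα
      (mem_supportFace_of_between (hle.trans haα.le) hθ.1 (by linarith [hn.1]) hφ hx)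
      (mem_supportFace_of_between hle (haα.le.trans hθ.1) (by linarith [hn.1]) hφ hx)
  · by_contra! hle
    exact disjoint_left.1 hβ
      (mem_supportFace_of_between hθ.2 (hβb.le.trans hle) hlt hx hφ)
      (mem_supportFace_of_between (hθ.2.trans hβb.le) hle hlt hx hφ)

theorem IsDualFrame.dist_ne_one_of_guard (h : IsDualFrame f g) {o : E} (ho : o ∈ interior C)
    (hle : ∀ x ∈ C, ∀ y ∈ C, dist x y ≤ 1)
    {a α β b θ θ' : ℝ} (haα : a < α) (hβb : β < b) (hab : b ≤ a + π)
    (hα : Disjoint (supportFace f g C α) (supportFace f g C a))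
    (hβ : Disjoint (supportFace f g C β) (supportFace f g C b))
    (hθ : θ ∈ Icc α β) (hθ' : θ' ∈ Icc α β) {x y : E} (hx : x ∈ supportFace f g C θ)
    (hy : y ∈ supportFace f g C θ') : dist x y ≠ 1 := by
  intro hxy
  obtain ⟨φ, hφx, hφy, -⟩ := h.exists_angle_of_dist_eq_one hle hx.1 hy.1 hxy
  obtain ⟨m, hm⟩ := h.exists_int_mem_Ioo ho haα hβb hα hβ hθ hx hφx
  obtain ⟨n, hn⟩ := h.exists_int_mem_Ioo ho haα hβb hα hβ hθ' hy hφy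
  -- The two lifted angles differ by an odd multiple of `π`, but lie in an open interval of length
  -- at most `π`.
  have h1 : ((2 * (n - m) + 1 : ℤ) : ℝ) * π < 1 * π := by push_cast; linarith [hm.1, hn.2]
  have h2 : (-1 : ℝ) * π < ((2 * (n - m) + 1 : ℤ) : ℝ) * π := by
    push_cast; linarith [hm.2, hn.1]
  have h3 := lt_of_mul_lt_mul_right h1 pi_pos.le
  have h4 := lt_of_mul_lt_mul_right h2 pi_pos.le
  have h5 : 2 * (n - m) + 1 < 1 := by exact_mod_cast h3
  have h6 : -1 < 2 * (n - m) + 1 := by exact_mod_cast h4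
  omega

/-- The union is the projection of a compact set of pairs (angle, point). -/
theorem isCompact_biUnion_supportFace (hC : IsCompact C) (α β : ℝ) :
    IsCompact (⋃ θ ∈ Icc α β, supportFace f g C θ) := by
  have heq : (⋃ θ ∈ Icc α β, supportFace f g C θ) = Prod.snd '' ((Icc α β ×ˢ C) ∩
      ⋂ y ∈ C, {p : ℝ × E | angleFunctional f g p.1 y ≤ angleFunctional f g p.1 p.2}) := by
    ext x
    simp only [supportFace, mem_iUnion, mem_ofPred_eq, exists_prop, mem_image, mem_inter_iff,
      mem_prod, mem_iInter, Prod.exists, exists_eq_right]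
    exact ⟨fun ⟨θ, hθ, hx, h⟩ => ⟨θ, ⟨hθ, hx⟩, h⟩, fun ⟨θ, ⟨hθ, hx⟩, h⟩ => ⟨θ, hθ, hx, h⟩⟩
  rw [heq]
  refine ((isCompact_Icc.prod hC).inter_right (isClosed_biInter fun y _ => ?_)).image
    continuous_snd
  simp only [angleFunctional_apply]
  exact isClosed_le (by fun_prop) (by fun_prop)

/-- Every point of a complete set lies between a given central point and a boundary point. -/
theorem IsDualFrame.exists_supportFace_segment [ProperSpace E] (h : IsDualFrame f g)
    (hC : IsDiametricallyComplete C) (hd : diam C = 1) {o x : E} (ho : ∀ y ∈ C, dist o y < 1)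
    (hx : x ∈ C) : ∃ θ, ∃ p ∈ supportFace f g C θ, x ∈ segment ℝ o p := by
  rcases eq_or_ne x o with rfl | hxo
  · obtain ⟨p, hp⟩ := (hC.isCompact hd).supportFace_nonempty (f := f) (g := g) ⟨x, hx⟩ 0
    exact ⟨0, p, hp, left_mem_segment ℝ x p⟩
  have hpos : 0 < ‖x - o‖ := norm_pos_iff.2 (sub_ne_zero.2 hxo)
  have hlt : ‖x - o‖ < 1 := by rw [← dist_eq_norm, dist_comm]; exact ho x hx
  -- This point of the ray from `o` through `x` is at distance one from `o`, hence outside `C`.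
  have hw : o + ‖x - o‖⁻¹ • (x - o) ∉ C := by
    intro hw
    have h1 := ho _ hw
    rw [dist_comm, dist_eq_norm, add_sub_cancel_left, norm_smul, norm_inv, norm_norm,
      inv_mul_cancel₀ hpos.ne'] at h1
    exact lt_irrefl _ h1
  obtain ⟨p, ⟨s, t, hs, ht, hst, rfl⟩, hpC, hpi⟩ :=
    exists_mem_segment_notMem_interior (hC.isClosed hd) hx hw
  obtain ⟨q, hq, hpq⟩ := hC.exists_dist_eq_one hd hpC hpi
  obtain ⟨φ, hφ, -⟩ := h.exists_angle_of_dist_eq_one (fun x hx y hy => hC.dist_le_one hd hx hy)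
    hpC hq hpq
  refine ⟨φ, _, hφ, ?_⟩
  have hR : 1 ≤ ‖x - o‖⁻¹ := (one_le_inv₀ hpos).2 hlt.le
  set c := s + t * ‖x - o‖⁻¹ with hc
  have hc1 : 1 ≤ c := by nlinarith
  have hc0 : c ≠ 0 := by positivity
  have hp : s • x + t • (o + ‖x - o‖⁻¹ • (x - o)) = o + c • (x - o) := by
    obtain rfl : s = 1 - t := by linarith
    rw [hc]; module
  rw [hp]
  refine ⟨1 - c⁻¹, c⁻¹, sub_nonneg.2 (inv_le_one_of_one_le₀ hc1), by positivity, by ring, ?_⟩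
  rw [smul_add, inv_smul_smul₀ hc0]
  module

theorem exists_partition_interval {b : ℕ → ℝ} {n : ℕ} {y : ℝ} (h0 : b 0 ≤ y) (hn : y < b n) :
    ∃ m < n, y ∈ Icc (b m) (b (m + 1)) := by
  induction n with
  | zero => exact absurd hn h0.not_gt
  | succ n ih =>
    rcases lt_or_ge y (b n) with h | h
    · obtain ⟨m, hm, hy⟩ := ih h
      exact ⟨m, hm.trans n.lt_succ_self, hy⟩
    · exact ⟨n, n.lt_succ_self, h, hn.le⟩

/-- A subdivision of `k` full turns into `n` arcs of normal angles, none of which carries a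
diametral pair, gives a `k`-fold Borsuk covering with `n` members. -/
theorem IsDualFrame.exists_covering_of_subdivision [ProperSpace E] (h : IsDualFrame f g)
    (hC : IsDiametricallyComplete C) (hd : diam C = 1) {k n : ℕ} {b : ℕ → ℝ}
    (hb : b n = b 0 + k * (2 * π))
    (hstep : ∀ m < n, b (m + 1) < b m + 2 * π)
    (hdist : ∀ m < n, ∀ θ ∈ Icc (b m) (b (m + 1)), ∀ θ' ∈ Icc (b m) (b (m + 1)),
      ∀ x ∈ supportFace f g C θ, ∀ y ∈ supportFace f g C θ', dist x y ≠ 1) :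
    ∃ F : Fin n → Set E, IsKFoldBorsukCovering k C F := by
  have hcpt := hC.isCompact hd
  have hconv := hC.convex hd
  obtain ⟨o, hoC, ho⟩ := hC.exists_forall_dist_lt_one hd
  have hoi := hC.mem_interior hd ho
  let A : ℕ → Set E := fun m => insert o (⋃ θ ∈ Icc (b m) (b (m + 1)), supportFace f g C θ)
  have hA : ∀ m, IsCompact (A m) := fun m => (isCompact_biUnion_supportFace hcpt _ _).insert o
  have hAC : ∀ m, A m ⊆ C := fun m =>
    insert_subset hoC (iUnion₂_subset fun θ _ => supportFace_subset θ)
  have hAlt : ∀ m < n, ∀ x ∈ A m, ∀ y ∈ A m, dist x y < 1 := by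
    rintro m hm x (rfl | hx) y (rfl | hy)
    · simp
    · exact ho y (hAC m (Or.inr hy))
    · rw [dist_comm]; exact ho x (hAC m (Or.inr hx))
    · refine lt_of_le_of_ne (hC.dist_le_one hd (hAC m (Or.inr hx)) (hAC m (Or.inr hy))) ?_
      obtain ⟨θ, hθ, hx⟩ := mem_iUnion₂.1 hx
      obtain ⟨θ', hθ', hy⟩ := mem_iUnion₂.1 hy
      exact hdist m hm θ hθ θ' hθ' x hx y hy
  -- Convex hulls keep the diameter, which compactness makes strictly less than one; the apex `o`
  -- brings in the interior points.
  refine ⟨fun i => convexHull ℝ (A i), fun i => ⟨convexHull_min (hAC i) hconv, ?_⟩, fun x hx => ?_⟩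
  · rw [convexHull_diam, hd]
    obtain ⟨p, hp, hmax⟩ := ((hA i).prod (hA i)).exists_isMaxOn
      ⟨(o, o), mem_insert _ _, mem_insert _ _⟩ (continuous_dist (α := E)).continuousOn
    refine (diam_le_of_forall_dist_le dist_nonneg fun x hx y hy => ?_).trans_lt
      (hAlt i i.2 p.1 hp.1 p.2 hp.2)
    exact hmax (show (x, y) ∈ A i ×ˢ A i from ⟨hx, hy⟩)
  · obtain ⟨θ, p, hp, hxp⟩ : ∃ θ, ∃ p ∈ supportFace f g C θ, x ∈ segment ℝ o p :=
      h.exists_supportFace_segment hC hd ho hx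
    obtain ⟨N, hN, -⟩ := existsUnique_add_zsmul_mem_Ico two_pi_pos θ (b 0)
    rw [zsmul_eq_mul] at hN
    rw [← supportFace_add_int_mul_two_pi θ N] at hp
    set ψ := θ + N * (2 * π) with hψ
    -- The `k` lifts of the normal angle lie in distinct arcs, since each arc is shorter than a full
    -- turn.
    have hex : ∀ j : Fin k, ∃ m : Fin n, ψ + (j : ℕ) * (2 * π) ∈ Icc (b m) (b (m + 1)) := by
      intro j
      have hj : ((j : ℕ) : ℝ) + 1 ≤ k := by exact_mod_cast j.2
      have hj' := mul_le_mul_of_nonneg_right hj two_pi_pos.le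
      have hj0 : (0 : ℝ) ≤ (j : ℕ) * (2 * π) := by positivity
      obtain ⟨m, hm, hmem⟩ := exists_partition_interval (b := b) (n := n)
        (y := ψ + (j : ℕ) * (2 * π)) (by linarith [hN.1]) (by rw [hb]; linarith [hN.2])
      exact ⟨⟨m, hm⟩, hmem⟩
    choose m hm using hex
    have hinj : Function.Injective m := by
      have key : ∀ i j : Fin k, m i = m j → (j : ℕ) ≤ i := by
        intro i j hij
        by_contra! hlt
        have h1 : ((i : ℕ) : ℝ) + 1 ≤ (j : ℕ) := by exact_mod_cast hlt
        have h1' := mul_le_mul_of_nonneg_right h1 two_pi_pos.le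
        have h2 := (hm i).1
        have h3 := (hm j).2
        rw [hij] at h2
        linarith [hstep (m j) (m j).2]
      intro i j hij
      exact Fin.ext (le_antisymm (key j i hij.symm) (key i j hij))
    have hsub : m '' univ ⊆ {i : Fin n | x ∈ convexHull ℝ (A i)} := by
      rintro _ ⟨j, -, rfl⟩
      have hpA : p ∈ A (m j) := by
        refine Or.inr (mem_iUnion₂.2 ⟨_, hm j, ?_⟩)
        have := supportFace_add_int_mul_two_pi (f := f) (g := g) (C := C) ψ ((j : ℕ) : ℤ)
        rw [Int.cast_natCast] at this
        rwa [this]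
      exact segment_subset_convexHull (mem_insert _ _) hpA hxp
    calc k = (m '' univ).ncard := by
          rw [ncard_image_of_injective _ hinj, ncard_univ, Nat.card_eq_fintype_card,
            Fintype.card_fin]
      _ ≤ _ := ncard_le_ncard hsub (toFinite _)

end Covering

/-! ### Accumulating normals and the optimal covering. -/

section Accumulation

variable {E : Type*} [NormedAddCommGroup E] [NormedSpace ℝ E] {f g : StrongDual ℝ E} {C : Set E}

/-- No interval of angles starting at `u` consists of normal angles, or of opposite normal angles,
of one point of `C`. -/
def NormalsAccumulate (f g : StrongDual ℝ E) (C : Set E) (u : ℝ) : Prop :=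
  ∀ δ > u, ∀ x ∈ C, (∃ θ ∈ Ioo u δ, x ∉ supportFace f g C θ) ∧
    ∃ θ ∈ Ioo u δ, x ∉ supportFace f g C (θ + π)

/-- Every face at a slightly smaller angle that meets the face at `w + n * π` contains its endpoint
`l`, and accumulation provides an angle whose face misses `l`. -/
theorem NormalsAccumulate.exists_disjoint {u : ℝ} (hu : NormalsAccumulate f g C u)
    (hC : IsCompact C) (hne : C.Nonempty) (n : ℕ) {w : ℝ} (hw : w ∈ Ioo u (u + π)) :
    ∃ θ ∈ Ioo u w,
      Disjoint (supportFace f g C (θ + n * π)) (supportFace f g C (w + n * π)) := by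
  obtain ⟨l, hl, hlθ⟩ := exists_supportFace_endpoint (f := f) (g := g) hC hne (w + n * π)
  have hex : ∃ θ ∈ Ioo u w, l ∉ supportFace f g C (θ + n * π) := by
    obtain ⟨⟨θ, hθ, h1⟩, ⟨θ', hθ', h2⟩⟩ := hu w hw.1 l hl.1
    by_cases h : l ∈ supportFace f g C (θ + n * π)
    · refine ⟨θ', hθ', ?_⟩
      -- The parity of `n` decides which half of `NormalsAccumulate` applies.
      rcases Nat.even_or_odd' n with ⟨m, rfl | rfl⟩
      · exfalso
        apply h1
        rw [← supportFace_add_int_mul_two_pi θ m]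
        convert h using 2
        push_cast; ring
      · rw [← supportFace_add_int_mul_two_pi (θ' + π) m] at h2
        convert h2 using 3
        push_cast; ring
    · exact ⟨θ, hθ, h⟩
  obtain ⟨θ, hθ, hlnot⟩ := hex
  refine ⟨θ, hθ, ?_⟩
  by_contra hdis
  exact hlnot (hlθ _ (by linarith [hθ.1, hw.2]) (by linarith [hθ.2]) hdis)

theorem NormalsAccumulate.exists_chain {u : ℝ} (hu : NormalsAccumulate f g C u)
    (hC : IsCompact C) (hne : C.Nonempty) :
    ∃ s α : ℕ → ℝ, ∀ n : ℕ, s n ∈ Ioo u (u + π) ∧ s (n + 1) < α n ∧ α n < s n ∧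
      Disjoint (supportFace f g C (α n + n * π)) (supportFace f g C (s n + n * π)) ∧
      Disjoint (supportFace f g C (α n + n * π)) (supportFace f g C (s (n + 1) + n * π)) := by
  have step : ∀ (n : ℕ) (w : Ioo u (u + π)), ∃ (α : ℝ) (v : Ioo u (u + π)),
      (v : ℝ) < α ∧ α < w ∧
      Disjoint (supportFace f g C (α + n * π)) (supportFace f g C (w + n * π)) ∧
      Disjoint (supportFace f g C (α + n * π)) (supportFace f g C (v + n * π)) := by
    intro n w
    obtain ⟨α, hα, h1⟩ := hu.exists_disjoint hC hne n w.2
    obtain ⟨v, hv, h2⟩ := hu.exists_disjoint hC hne n ⟨hα.1, hα.2.trans w.2.2⟩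
    exact ⟨α, ⟨v, hv.1, hv.2.trans (hα.2.trans w.2.2)⟩, hv.2, hα.2, h1, h2.symm⟩
  choose A S hA using step
  let s : ℕ → Ioo u (u + π) := fun n =>
    Nat.rec ⟨u + π / 2, by constructor <;> linarith [pi_pos]⟩ (fun n w => S n w) n
  exact ⟨fun n => (s n).1, fun n => A n (s n), fun n => ⟨(s n).2, hA n (s n)⟩⟩

theorem NormalsAccumulate.exists_covering [ProperSpace E] {u : ℝ}
    (hu : NormalsAccumulate f g C u) (h : IsDualFrame f g) (hC : IsDiametricallyComplete C)
    (hd : diam C = 1) (k : ℕ) : ∃ F : Fin (2 * k + 1) → Set E, IsKFoldBorsukCovering k C F := by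
  obtain ⟨o, -, ho⟩ := hC.exists_forall_dist_lt_one hd
  have hoi := hC.mem_interior hd ho
  obtain ⟨s, α, hsα⟩ := hu.exists_chain (hC.isCompact hd)
    (IsDiametricallyComplete.nonempty_of_diam_eq_one hd)
  have hα : ∀ n, α n ∈ Ioo u (u + π) := fun n =>
    ⟨(hsα (n + 1)).1.1.trans (hsα n).2.1, (hsα n).2.2.1.trans (hsα n).1.2⟩
  -- As `α` decreases, each of the first `2 * k` arcs is shorter than `π`, with fences at `s (m + 1)
  -- + m * π` and `s (m + 1) + (m + 1) * π`. The last arc makes up the accumulated deficit `α 0 - α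
  -- (2 * k)`.
  set b : ℕ → ℝ := fun m => if m ≤ 2 * k then α m + m * π else α 0 + (2 * k : ℕ) * π with hb
  have hb0 : b 0 = α 0 := by simp [hb]
  have hblast : b (2 * k + 1) = α 0 + (2 * k : ℕ) * π := by simp [hb]
  have hbm : ∀ m ≤ 2 * k, b m = α m + m * π := fun m hm => by simp [hb, hm]
  refine h.exists_covering_of_subdivision hC hd (b := b) ?_ ?_ ?_
  · rw [hblast, hb0]; push_cast; ring
  · intro m hm
    rcases Nat.lt_succ_iff_lt_or_eq.1 hm with hlt | rfl
    · rw [hbm m hlt.le, hbm (m + 1) hlt]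
      push_cast
      linarith [(hα m).1, (hα (m + 1)).2]
    · rw [hblast, hbm _ le_rfl]
      linarith [(hα (2 * k)).1, (hα 0).2, pi_pos]
  · intro m hm θ hθ θ' hθ' x hx y hy
    have hle := fun x hx y hy => hC.dist_le_one hd (x := x) (y := y) hx hy
    rcases Nat.lt_succ_iff_lt_or_eq.1 hm with hlt | rfl
    · rw [hbm m hlt.le, hbm (m + 1) hlt] at hθ hθ'
      refine h.dist_ne_one_of_guard hoi hle (a := s (m + 1) + m * π)
        (b := s (m + 1) + (m + 1 : ℕ) * π) ?_ ?_ ?_ (hsα m).2.2.2.2 (hsα (m + 1)).2.2.2.1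
        hθ hθ' hx hy
      · linarith [(hsα m).2.1]
      · linarith [(hsα (m + 1)).2.2.1]
      · push_cast; linarith
    · rw [hblast, hbm _ le_rfl] at hθ hθ'
      refine h.dist_ne_one_of_guard hoi hle (a := s (2 * k + 1) + (2 * k : ℕ) * π)
        (b := s 0 + (2 * k : ℕ) * π) ?_ ?_ ?_ (hsα (2 * k)).2.2.2.2 ?_ hθ hθ' hx hy
      · linarith [(hsα (2 * k)).2.1]
      · linarith [(hsα 0).2.2.1]
      · linarith [(hsα 0).1.2, (hsα (2 * k + 1)).1.1]
      · have key : ∀ t : ℝ, supportFace f g C (t + (2 * k : ℕ) * π) = supportFace f g C t := by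
          intro t
          rw [← supportFace_add_int_mul_two_pi t k]
          congr 1; push_cast; ring
        rw [key, key]
        simpa using (hsα 0).2.2.2.1

/-! ### Finitely many partners and Reuleaux polygons. -/

/-- Finitely many points of `C` contain a diametral partner of each endpoint of a diameter of `C`
whose normal angle lies in `U`. -/
def HasFinitePartners (f g : StrongDual ℝ E) (C : Set E) (U : Set ℝ) : Prop :=
  ∃ X : Finset E, ↑X ⊆ C ∧ ∀ θ ∈ U, ∀ p ∈ supportFace f g C θ, ∀ q ∈ C,
    angleFunctional f g θ (p - q) = ‖angleFunctional f g θ‖ → ∃ x ∈ X, dist p x = 1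

namespace HasFinitePartners

theorem empty : HasFinitePartners f g C ∅ := ⟨∅, by simp, by simp⟩

theorem mono {U V : Set ℝ} (hUV : U ⊆ V) (hV : HasFinitePartners f g C V) :
    HasFinitePartners f g C U := by
  obtain ⟨X, hX, h⟩ := hV
  exact ⟨X, hX, fun θ hθ => h θ (hUV hθ)⟩

theorem union {U V : Set ℝ} (hU : HasFinitePartners f g C U) (hV : HasFinitePartners f g C V) :
    HasFinitePartners f g C (U ∪ V) := by
  classical
  obtain ⟨X, hX, h⟩ := hU
  obtain ⟨Y, hY, h'⟩ := hV
  refine ⟨X ∪ Y, by simp [hX, hY], ?_⟩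
  rintro θ (hθ | hθ) p hp q hq hpq
  · obtain ⟨x, hx, hpx⟩ := h θ hθ p hp q hq hpq
    exact ⟨x, Finset.mem_union_left _ hx, hpx⟩
  · obtain ⟨x, hx, hpx⟩ := h' θ hθ p hp q hq hpq
    exact ⟨x, Finset.mem_union_right _ hx, hpx⟩

/-- Since `x` minimizes each functional on `C`, it can replace the other end `q` of every such
diameter. -/
theorem of_opposite (hfr : IsDualFrame f g) (hle : ∀ x ∈ C, ∀ y ∈ C, dist x y ≤ 1) {U : Set ℝ}
    {x : E} (hx : x ∈ C) (hU : ∀ θ ∈ U, x ∈ supportFace f g C (θ + π)) :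
    HasFinitePartners f g C U := by
  refine ⟨{x}, by simpa using hx, fun θ hθ p hp q hq hpq => ⟨x, by simp, ?_⟩⟩
  refine le_antisymm (hle p hp.1 x hx) ?_
  have h1 := (mem_supportFace_add_pi.1 (hU θ hθ)).2 q hq
  have h2 : ‖angleFunctional f g θ‖ * 1 ≤ ‖angleFunctional f g θ‖ * ‖p - x‖ := by
    calc ‖angleFunctional f g θ‖ * 1 = angleFunctional f g θ (p - q) := by rw [mul_one, hpq]
      _ ≤ angleFunctional f g θ (p - x) := by simp only [map_sub]; linarith
      _ ≤ _ := (le_abs_self _).trans ((angleFunctional f g θ).le_opNorm (p - x))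
  rw [dist_eq_norm]
  exact le_of_mul_le_mul_left h2 (norm_pos_iff.2 (hfr.angleFunctional_ne_zero θ))

/-- Each face over the open interval is just `{x}`, so one partner of `x` serves all angles. -/
theorem of_Ioo (hfr : IsDualFrame f g) (hle : ∀ x ∈ C, ∀ y ∈ C, dist x y ≤ 1) {u v : ℝ}
    {x : E} (hU : ∀ θ ∈ Ioo u v, x ∈ supportFace f g C θ) :
    HasFinitePartners f g C (Ioo u v) := by
  have hdist : ∀ θ ∈ Ioo u v, ∀ p ∈ supportFace f g C θ, ∀ q ∈ C,
      angleFunctional f g θ (p - q) = ‖angleFunctional f g θ‖ → p = x ∧ dist x q = 1 := by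
    intro θ hθ p hp q hq hpq
    obtain ⟨α, hα1, hα2⟩ := exists_between (max_lt hθ.1 (sub_lt_self θ (half_pos pi_pos)))
    obtain ⟨β, hβ1, hβ2⟩ := exists_between (lt_min hθ.2 (lt_add_of_pos_right θ (half_pos pi_pos)))
    rw [max_lt_iff] at hα1
    rw [lt_min_iff] at hβ2
    have hpx : p = x := hfr.eq_of_mem_supportFace hα2 hβ1 (by linarith)
      (hU α ⟨hα1.1, hα2.trans hθ.2⟩) (hU β ⟨hθ.1.trans hβ1, hβ2.1⟩) hp
    subst hpx
    refine ⟨rfl, le_antisymm (hle p hp.1 q hq) ?_⟩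
    have h2 : ‖angleFunctional f g θ‖ * 1 ≤ ‖angleFunctional f g θ‖ * ‖p - q‖ := by
      rw [mul_one, ← hpq]
      conv_rhs => rw [hpq]
      exact (le_abs_self _).trans ((angleFunctional f g θ).le_opNorm (p - q))
    rw [dist_eq_norm]
    exact le_of_mul_le_mul_left h2 (norm_pos_iff.2 (hfr.angleFunctional_ne_zero θ))
  by_cases hq : ∃ q ∈ C, dist x q = 1
  · obtain ⟨q, hq, hxq⟩ := hq
    refine ⟨{q}, by simpa using hq, fun θ hθ p hp q' hq' hpq => ⟨q, by simp, ?_⟩⟩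
    rw [(hdist θ hθ p hp q' hq' hpq).1, hxq]
  · refine ⟨∅, by simp, fun θ hθ p hp q' hq' hpq => absurd ⟨q', hq', ?_⟩ hq⟩
    exact (hdist θ hθ p hp q' hq' hpq).2

theorem exists_Ioo_right (hfr : IsDualFrame f g) (hle : ∀ x ∈ C, ∀ y ∈ C, dist x y ≤ 1) {u : ℝ}
    (hu : ¬ NormalsAccumulate f g C u) : ∃ δ > u, HasFinitePartners f g C (Ioo u δ) := by
  simp only [NormalsAccumulate, not_forall, not_and_or, not_exists, not_not] at hu
  obtain ⟨δ, hδ, x, hx, h | h⟩ := hu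
  · exact ⟨δ, hδ, of_Ioo hfr hle fun θ hθ => (h θ).resolve_left (not_not.2 hθ)⟩
  · exact ⟨δ, hδ, of_opposite hfr hle hx fun θ hθ => (h θ).resolve_left (not_not.2 hθ)⟩

theorem exists_Ioo_left (hfr : IsDualFrame f g) (hle : ∀ x ∈ C, ∀ y ∈ C, dist x y ≤ 1) {u : ℝ}
    (hu : ¬ NormalsAccumulate f (-g) C (-u)) : ∃ δ < u, HasFinitePartners f g C (Ioo δ u) := by
  simp only [NormalsAccumulate, not_forall, not_and_or, not_exists, not_not,
    supportFace_neg_right] at hu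
  obtain ⟨δ, hδ, x, hx, h | h⟩ := hu
  · refine ⟨-δ, by linarith, of_Ioo (x := x) hfr hle fun θ hθ => ?_⟩
    simpa using (h (-θ)).resolve_left (not_not.2 ⟨by linarith [hθ.2], by linarith [hθ.1]⟩)
  · refine ⟨-δ, by linarith, of_opposite hfr hle hx fun θ hθ => ?_⟩
    have := (h (-θ)).resolve_left (not_not.2 ⟨by linarith [hθ.2], by linarith [hθ.1]⟩)
    -- The mirrored angle `-(-θ + π)` is a full turn short of `θ + π`.
    rw [← supportFace_add_int_mul_two_pi _ 1] at this
    convert this using 2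
    push_cast; ring

end HasFinitePartners

theorem IsDualFrame.isReuleauxPolygon [ProperSpace E] (hfr : IsDualFrame f g)
    (hC : IsDiametricallyComplete C) (hd : diam C = 1)
    (hr : ∀ u, ¬ NormalsAccumulate f g C u) (hl : ∀ u, ¬ NormalsAccumulate f (-g) C u) :
    IsReuleauxPolygon C := by
  have hle := fun x hx y hy => hC.dist_le_one hd (x := x) (y := y) hx hy
  have hne := IsDiametricallyComplete.nonempty_of_diam_eq_one hd
  obtain ⟨o, hoC, ho⟩ := hC.exists_forall_dist_lt_one hd
  have hoi := hC.mem_interior hd ho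
  obtain ⟨X, hXC, hX⟩ : HasFinitePartners f g C (Icc 0 (2 * π)) := by
    refine isCompact_Icc.induction_on .empty (fun U V => .mono) (fun U V => .union) fun u _ => ?_
    obtain ⟨δ, hδ, h1⟩ := HasFinitePartners.exists_Ioo_right hfr hle (hr u)
    obtain ⟨ε, hε, h2⟩ := HasFinitePartners.exists_Ioo_left hfr hle (hl (-u))
    obtain ⟨x, hx⟩ := (hC.isCompact hd).supportFace_nonempty (f := f) (g := g) hne (u + π)
    have h3 : HasFinitePartners f g C {u} := .of_opposite hfr hle hx.1 (by simpa using hx)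
    refine ⟨Ioo ε δ, mem_nhdsWithin_of_mem_nhds (Ioo_mem_nhds hε hδ),
      ((h2.union h3).union h1).mono fun θ hθ => ?_⟩
    rcases lt_trichotomy θ u with h | h | h
    · exact Or.inl (Or.inl ⟨hθ.1, h⟩)
    · exact Or.inl (Or.inr h)
    · exact Or.inr ⟨h, hθ.2⟩
  refine ⟨hC, X, Subset.antisymm (fun y hy => mem_iInter₂.2 fun x hx => hle y hy x (hXC hx))
    fun z hz => ?_⟩
  by_contra hzC
  obtain ⟨p, ⟨s, t, hs, ht, hst, hp⟩, hpC, hpi⟩ :=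
    exists_mem_segment_notMem_interior (hC.isClosed hd) hoC hzC
  obtain ⟨q, hq, hpq⟩ := hC.exists_dist_eq_one hd hpC hpi
  obtain ⟨φ, hφ, -, hφq⟩ := hfr.exists_angle_of_dist_eq_one hle hpC hq hpq
  obtain ⟨N, hN, -⟩ := existsUnique_add_zsmul_mem_Ico two_pi_pos φ 0
  rw [zsmul_eq_mul, zero_add] at hN
  rw [← supportFace_add_int_mul_two_pi φ N] at hφ
  rw [← angleFunctional_add_int_mul_two_pi f g φ N] at hφq
  obtain ⟨x, hx, hpx⟩ := hX _ ⟨hN.1, hN.2.le⟩ p hφ q hq hφq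
  -- For the functional norming `p - x`, the value at `z` is at most that at `p` and the value at
  -- `o` is strictly smaller, so `p` lies on the segment from `o` to `z` only if `p = z`.
  obtain ⟨ψ, hψ, -, hψx⟩ := hfr.exists_angle_of_dist_eq_one hle hpC (hXC hx) hpx
  have hne0 := hfr.angleFunctional_ne_zero ψ
  have hlt := lt_of_mem_interior hoi hne0 hψ.2
  have hzx : ‖z - x‖ ≤ 1 := by rw [← dist_eq_norm]; exact mem_iInter₂.1 hz x hx
  have hz1 : angleFunctional f g ψ (z - x) ≤ ‖angleFunctional f g ψ‖ * 1 :=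
    ((le_abs_self _).trans ((angleFunctional f g ψ).le_opNorm _)).trans
      (mul_le_mul_of_nonneg_left hzx (norm_nonneg _))
  rw [mul_one, ← hψx, map_sub, map_sub] at hz1
  have hval : angleFunctional f g ψ p =
      s * angleFunctional f g ψ o + t * angleFunctional f g ψ z := by
    rw [← hp]; simp
  obtain rfl : t = 1 - s := by linarith
  rcases eq_or_lt_of_le hs with h0 | h0
  · subst h0
    apply hzC
    simp only [zero_smul, sub_zero, one_smul, zero_add] at hp
    exact hp ▸ hpC
  · nlinarith

theorem exists_isDualFrame (hE : Module.finrank ℝ E = 2) :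
    ∃ f g : StrongDual ℝ E, IsDualFrame f g := by
  have : FiniteDimensional ℝ E := .of_finrank_pos (by omega)
  let b := Module.finBasisOfFinrankEq ℝ E hE
  have hf : ∀ i x, LinearMap.toContinuousLinearMap (b.coord i) x = b.repr x i := fun i x => rfl
  refine ⟨LinearMap.toContinuousLinearMap (b.coord 0),
    LinearMap.toContinuousLinearMap (b.coord 1), fun φ => ⟨φ (b 0), φ (b 1), ?_⟩, ?_⟩
  · ext x
    have hx := congrArg φ (b.sum_repr x)
    rw [Fin.sum_univ_two, map_add, map_smul, map_smul] at hx
    simp [hf, ← hx, mul_comm]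
  · intro c d h
    have h0 := DFunLike.congr_fun h (b 0)
    have h1 := DFunLike.congr_fun h (b 1)
    simp [hf] at h0 h1
    exact ⟨h0, h1⟩

end Accumulation

end

theorem mainTheorem2 {E : Type*} [NormedAddCommGroup E] [NormedSpace ℝ E]
    (hE : Module.finrank ℝ E = 2) (C : Set E) (hC : IsDiametricallyComplete C)
    (hdiam : Metric.diam C = 1) (hR : ¬ IsReuleauxPolygon C) (k : ℕ) (hk : 1 ≤ k) :
    kFoldBorsukNumber k C = ((2 * k + 1 : ℕ) : ℕ∞) := by
  have : FiniteDimensional ℝ E := .of_finrank_pos (by omega)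
  have : ProperSpace E := FiniteDimensional.proper ℝ E
  obtain ⟨f, g, hfr⟩ := exists_isDualFrame hE
  apply le_antisymm
  · have hex : ∃ F : Fin (2 * k + 1) → Set E, IsKFoldBorsukCovering k C F := by
      by_contra hno
      refine hR (hfr.isReuleauxPolygon hC hdiam (fun u hu => hno ?_) fun u hu => hno ?_)
      · exact hu.exists_covering hfr hC hdiam k
      · exact hu.exists_covering hfr.neg_right hC hdiam k
    exact iInf₂_le (2 * k + 1) hex
  · refine le_iInf₂ fun n ⟨F, hF⟩ => ?_
    have hrank : 1 < Module.rank ℝ E := by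
      rw [← Module.finrank_eq_rank, hE]
      norm_num
    exact_mod_cast hF.two_mul_lt hrank hC hdiam hk
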